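/- Let $n\ge 0$ and let $k_1<k_2<\dots<k_n$ be integers. A monotone triangle with $n$ rows is an array of integers $(a_{i,j})_{1\le i\le j\le n}$ such that $a_{i,j}\le a_{i+1,j+1}$ for $1\le i\le j<n$, $a_{i,j}\le a_{i-1,j}$ for $1<i\le j\le n$, and $a_{i,j}<a_{i,j+1}$ for $1\le i\le j\le n-1$; its bottom row is $(a_{1,1},a_{1,2},\dots,a_{1,n})$. Its $Q$-weight is $Q^{m}$, where $m$ is the number of entries $a_{i,j}$ with $2\le i\le j\le n$ and $a_{i-1,j-1}<a_{i,j}<a_{i-1,j}$. Here $Q$ is an indeterminate over $\mathbb{Q}$ or, more generally, any element of a commutative $\mathbb{Q}$-algebra. For a function $p$ of $(k_1,\dots,k_n)\in\mathbb{Z}^n$, let $E_{k_s}p$ be the function obtained by replacing $k_s$ with $k_s+1$; products of operators are compositions (all the operators below commute). Then there are finitely many monotone triangles with bottom row $(k_1,\dots,k_n)$, and the sum of their $Q$-weights equals the value at $(k_1,\dots,k_n)$ of $$\prod_{1\le s<t\le n}\bigl(\operatorname{id}-(2-Q)\,E_{k_s}+E_{k_s}E_{k_t}\bigr)\ \prod_{1\le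 i<j\le n}\frac{k_j-k_i}{j-i}.$$ -/

import Mathlib

/-- A monotone triangle with `n` rows.  Rows and diagonals are numbered from `0`: the entry
`entry i j` is defined for `i ≤ j < n`, row `0` is the bottom row (with `n` entries) and row `n - 1`
is the top row (with one entry).  The upper neighbours of `entry i j` are `entry (i + 1) j` (to the
left) and `entry (i + 1) (j + 1)` (to the right).  Outside the triangle `entry` is normalized to
`0`, so that two triangles are equal exactly when their entries are. -/
@[ext]
structure MonotoneTriangle (n : ℕ) where
  /-- The entries of the triangle. -/
  entry : ℕ → ℕ → ℤ
  /-- The entries increase weakly in northeast direction. -/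
  northeast : ∀ i j, i ≤ j → j + 1 < n → entry i j ≤ entry (i + 1) (j + 1)
  /-- The entries increase weakly in southeast direction. -/
  southeast : ∀ i j, i + 1 ≤ j → j < n → entry (i + 1) j ≤ entry i j
  /-- The entries increase strictly along rows. -/
  row_strict : ∀ i j, i ≤ j → j + 1 < n → entry i j < entry i (j + 1)
  /-- There is nothing outside the triangle. -/
  zeros : ∀ i j, ¬ (i ≤ j ∧ j < n) → entry i j = 0

namespace MonotoneTriangle

/-- The bottom row of a monotone triangle. -/
def bottomRow {n : ℕ} (T : MonotoneTriangle n) : Fin n → ℤ := fun j => T.entry 0 j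

/-- The number of entries, not in the bottom row, that lie strictly between their two lower
neighbours: `entry (i + 1) (j + 1)` has the lower neighbours `entry i j` and `entry i (j + 1)`. -/
def numStrictlyBetween {n : ℕ} (T : MonotoneTriangle n) : ℕ :=
  ((Finset.range n ×ˢ Finset.range n).filter fun p =>
    p.1 ≤ p.2 ∧ p.2 + 1 < n ∧
      T.entry p.1 p.2 < T.entry (p.1 + 1) (p.2 + 1) ∧
      T.entry (p.1 + 1) (p.2 + 1) < T.entry p.1 (p.2 + 1)).card

theorem entry_le_bottom {n : ℕ} (T : MonotoneTriangle n) (j : ℕ) (hj : j < n) :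
    ∀ i, i ≤ j → T.entry i j ≤ T.entry 0 j
  | 0, _ => le_rfl
  | i + 1, hi => (T.southeast i j hi hj).trans (entry_le_bottom T j hj i (by omega))

theorem bottom_le_entry {n : ℕ} (T : MonotoneTriangle n) (d : ℕ) :
    ∀ i, i + d < n → T.entry 0 d ≤ T.entry i (i + d)
  | 0, _ => by simp
  | i + 1, hi => by
    have h1 := bottom_le_entry T d i (by omega)
    have h2 := T.northeast i (i + d) (by omega) (by omega)
    have h3 : i + 1 + d = i + d + 1 := by omega
    rw [h3]
    exact h1.trans h2

/-- There are only finitely many monotone triangles with a given bottom row. -/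
theorem finite_bottomRow_eq {n : ℕ} (k : Fin n → ℤ) :
    {T : MonotoneTriangle n | T.bottomRow = k}.Finite := by
  let B : ℤ := ∑ j, |k j|
  have hB : ∀ j, |k j| ≤ B := fun j =>
    Finset.single_le_sum (f := fun j => |k j|) (fun _ _ => abs_nonneg _) (Finset.mem_univ j)
  have hB0 : 0 ≤ B := Finset.sum_nonneg fun _ _ => abs_nonneg _
  let φ : MonotoneTriangle n → Fin n → Fin n → ℤ := fun T i j => T.entry i j
  refine Set.Finite.of_finite_image (f := φ) ?_ ?_
  · refine Set.Finite.subset (Set.Finite.pi' (fun _ : Fin n => Set.Finite.pi' fun _ : Fin n =>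
      Set.finite_Icc (-B) B)) ?_
    rintro _ ⟨T, hT, rfl⟩ i j
    have hT' : ∀ l (hl : l < n), T.entry 0 l = k ⟨l, hl⟩ := fun l hl => congrFun hT ⟨l, hl⟩
    show T.entry i j ∈ Set.Icc (-B) B
    by_cases hij : (i : ℕ) ≤ j
    · have h1 := T.entry_le_bottom j j.2 i hij
      have h2 := T.bottom_le_entry (j - i) i (by omega)
      rw [Nat.add_sub_cancel' hij, hT' _ (by omega)] at h2
      rw [hT' _ j.2] at h1
      exact ⟨(abs_le.mp (hB _)).1.trans h2, h1.trans (abs_le.mp (hB _)).2⟩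
    · rw [T.zeros i j (fun h => hij h.1)]
      exact ⟨by omega, hB0⟩
  · intro T _ T' _ h
    ext i j
    by_cases hij : i ≤ j ∧ j < n
    · exact congrFun (congrFun h ⟨i, by omega⟩) ⟨j, hij.2⟩
    · rw [T.zeros i j hij, T'.zeros i j hij]

/-- The set of monotone triangles with bottom row `k`. -/
noncomputable def withBottomRow {n : ℕ} (k : Fin n → ℤ) : Finset (MonotoneTriangle n) :=
  (finite_bottomRow_eq k).toFinset

/-- The generating function of the monotone triangles with bottom row `k` with respect to the
`Q`-weight, which is `Q` to the number of entries strictly between their two lower neighbours. -/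
noncomputable def generatingFunction {R : Type*} [CommRing R] (Q : R) {n : ℕ} (k : Fin n → ℤ) : R :=
  ∑ T ∈ withBottomRow k, Q ^ T.numStrictlyBetween

end MonotoneTriangle

/-- The shift operator with respect to the variable `k_s`, acting on functions of
`(k_1, …, k_n)`: it replaces `k_s` by `k_s + 1`. -/
def shiftOp (R : Type*) [CommRing R] {n : ℕ} (s : Fin n) : Module.End R ((Fin n → ℤ) → R) where
  toFun f := fun k => f (k + Pi.single s 1)
  map_add' _ _ := rfl
  map_smul' _ _ := rfl

/-- The operator `id - (2 - Q) E_{k_s} + E_{k_s} E_{k_t}`; the product of operators is their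
composition. -/
def pairOp {R : Type*} [CommRing R] (Q : R) {n : ℕ} (s t : Fin n) :
    Module.End R ((Fin n → ℤ) → R) :=
  1 - (2 - Q) • shiftOp R s + shiftOp R s * shiftOp R t

theorem shiftOp_commute {R : Type*} [CommRing R] {n : ℕ} (s t : Fin n) :
    Commute (shiftOp R s) (shiftOp R t) := by
  refine LinearMap.ext fun f => funext fun k => ?_
  show f (k + Pi.single s 1 + Pi.single t 1) = f (k + Pi.single t 1 + Pi.single s 1)
  rw [add_right_comm]

theorem pairOp_commute {R : Type*} [CommRing R] (Q : R) {n : ℕ} (s t s' t' : Fin n) :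
    Commute (pairOp Q s t) (pairOp Q s' t') := by
  have key : ∀ A : Module.End R ((Fin n → ℤ) → R), (∀ u, Commute A (shiftOp R u)) →
      ∀ u v : Fin n, Commute A (pairOp Q u v) := fun A hA u v =>
    ((Commute.one_right A).sub_right ((hA u).smul_right _)).add_right ((hA u).mul_right (hA v))
  exact key _ (fun u => (key _ (fun v => shiftOp_commute u v) s t).symm) s' t'

/-- The product of the operators `id - (2 - Q) E_{k_s} + E_{k_s} E_{k_t}` over all pairs `s < t`,
that is, their composition in any order. -/
noncomputable def operatorProduct {R : Type*} [CommRing R] (Q : R) (n : ℕ) :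
    Module.End R ((Fin n → ℤ) → R) :=
  (Finset.univ.filter fun p : Fin n × Fin n => p.1 < p.2).noncommProd (fun p => pairOp Q p.1 p.2)
    (fun p _ q _ _ => pairOp_commute Q p.1 p.2 q.1 q.2)

/-- The function `(k_1, …, k_n) ↦ ∏_{i < j} (k_j - k_i) / (j - i)`, with its rational values read
in the `ℚ`-algebra `R`. -/
def vandermondeQuotient (R : Type*) [CommRing R] [Algebra ℚ R] (n : ℕ) : (Fin n → ℤ) → R :=
  fun k => ∏ p : Fin n × Fin n with p.1 < p.2,
    algebraMap ℚ R (((k p.2 : ℚ) - (k p.1 : ℚ)) / (((p.2 : ℕ) : ℚ) - ((p.1 : ℕ) : ℚ)))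

/-! The proof is by induction on the number of rows. Removing the bottom row `k` turns the
generating function into a weighted sum over the strictly increasing rows interlacing `k`
(`generatingFunction_succ`). The Vandermonde quotient is the determinant of the binomials `(k_i
choose j)`; by Pascal's rule it is the product of all difference operators applied to the
determinant of `(k_i choose j + 1)`. So the summand is a full difference of `f`, the operator
product applied to the latter determinant, and the sum should telescope.

The obstacle is strictness: two neighbouring entries must not both equal the `k_p` between them. The
correction for this cancels the unwanted boundary terms exactly when `id - (2 - Q) E_{i+1} + E_{i+1}
E_i` annihilates `f` on `l_i = l_{i+1}` (`rowSum_diffProd`). It does: multiplied by the operator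
product, this operator is symmetric in the two variables, while the determinant is antisymmetric
(`vanishesOnDiagonals_pairProd_binomDet`).

What remains is an alternating sum over the omitted `k_p`. Its edge operators are the pair operators
with `E_{k_p} = id`, so it is the next operator product applied to the Laplace expansion of the next
determinant along its row of ones (`alternatingSum_pairProd_binomDet`). -/

/-! ### Polynomials in the shift operators -/

open MvPolynomial in
/-- Polynomials in the shift operators, acting on functions of `(k_1, …, k_n)`. -/
noncomputable def shiftAction (R : Type*) [CommRing R] (n : ℕ) :
    MvPolynomial (Fin n) R →ₐ[R] Module.End R ((Fin n → ℤ) → R) :=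
  AddMonoidAlgebra.lift R _ _
    { toFun := fun m =>
        { toFun := fun f k => f (k + fun i => (m.toAdd i : ℤ))
          map_add' := fun _ _ => rfl
          map_smul' := fun _ _ => rfl }
      map_one' := by
        refine LinearMap.ext fun f => funext fun k => ?_
        exact congrArg f (funext fun i => by simp)
      map_mul' := fun a b => by
        refine LinearMap.ext fun f => funext fun k => ?_
        exact congrArg f (funext fun i => by simp; ring) }

section ShiftAction

open MvPolynomial

variable {R : Type*} [CommRing R]

@[simp]
theorem shiftAction_X {n : ℕ} (s : Fin n) : shiftAction R n (X s) = shiftOp R s := by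
  refine LinearMap.ext fun f => funext fun k => ?_
  have : (X s : MvPolynomial (Fin n) R) = AddMonoidAlgebra.single (Finsupp.single s 1) 1 := rfl
  rw [this, shiftAction, AddMonoidAlgebra.lift_single, one_smul]
  refine congrArg f (funext fun i => ?_)
  by_cases h : i = s
  · subst h; simp
  · simp [h, Finsupp.single_apply, Ne.symm h]

@[simp]
theorem shiftAction_C {n : ℕ} (c : R) : shiftAction R n (C c) = c • 1 := by
  rw [← algebraMap_eq, AlgHom.commutes, Algebra.algebraMap_eq_smul_one]

/-- A linear map that turns each shift operator into a polynomial in shift operators does so with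
all polynomials in shift operators. -/
theorem shiftAction_intertwine {m n : ℕ} (L : ((Fin m → ℤ) → R) →ₗ[R] ((Fin n → ℤ) → R))
    (q : Fin n → MvPolynomial (Fin m) R)
    (h : ∀ s f, shiftOp R s (L f) = L (shiftAction R m (q s) f))
    (p : MvPolynomial (Fin n) R) (f : (Fin m → ℤ) → R) :
    shiftAction R n p (L f) = L (shiftAction R m (aeval q p) f) := by
  induction p using MvPolynomial.induction_on generalizing f with
  | C c => simp
  | add p₁ p₂ h₁ h₂ => simp [h₁, h₂]
  | mul_X p s hp =>
    rw [map_mul, shiftAction_X, Module.End.mul_apply, h, hp, map_mul, aeval_X, map_mul,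
      Module.End.mul_apply]

/-- The polynomial in the shift operators that is `pairOp`. -/
noncomputable def pairPoly (Q : R) {n : ℕ} (s t : Fin n) : MvPolynomial (Fin n) R :=
  1 - C (2 - Q) * X s + X s * X t

theorem shiftAction_pairPoly (Q : R) {n : ℕ} (s t : Fin n) :
    shiftAction R n (pairPoly Q s t) = pairOp Q s t := by
  rw [pairPoly, pairOp, map_add, map_sub, map_mul, map_mul, shiftAction_C]
  simp

/-- The polynomial in the shift operators that is `operatorProduct`. -/
noncomputable def pairProd (Q : R) (n : ℕ) : MvPolynomial (Fin n) R :=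
  ∏ p : Fin n × Fin n with p.1 < p.2, pairPoly Q p.1 p.2

theorem shiftAction_pairProd (Q : R) (n : ℕ) :
    shiftAction R n (pairProd Q n) = operatorProduct Q n := by
  have h := Finset.map_noncommProd (Finset.univ.filter fun p : Fin n × Fin n => p.1 < p.2)
    (fun p => pairPoly Q p.1 p.2) (fun _ _ _ _ _ => Commute.all _ _) (shiftAction R n)
  rw [Finset.noncommProd_eq_prod] at h
  rw [pairProd, h]
  exact Finset.noncommProd_congr rfl (fun p _ => shiftAction_pairPoly Q p.1 p.2) _

/-- Fixing the first variable. -/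
def evalHead {n : ℕ} (x : ℤ) : ((Fin (n + 1) → ℤ) → R) →ₗ[R] ((Fin n → ℤ) → R) where
  toFun f := fun k => f (Fin.cons x k)
  map_add' _ _ := rfl
  map_smul' _ _ := rfl

theorem evalHead_apply {n : ℕ} (x : ℤ) (f : (Fin (n + 1) → ℤ) → R) (k : Fin n → ℤ) :
    evalHead x f k = f (Fin.cons x k) := rfl

theorem evalHead_shiftOp_zero {n : ℕ} (x : ℤ) (f : (Fin (n + 1) → ℤ) → R) :
    evalHead x (shiftOp R 0 f) = evalHead (x + 1) f := by
  funext k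
  refine congrArg f (funext fun i => ?_)
  cases i using Fin.cases <;> simp

theorem evalHead_shiftOp_succ {n : ℕ} (x : ℤ) (s : Fin n) (f : (Fin (n + 1) → ℤ) → R) :
    evalHead x (shiftOp R s.succ f) = shiftOp R s (evalHead x f) := by
  funext k
  refine congrArg f (funext fun i => ?_)
  cases i using Fin.cases with
  | zero => simp
  | succ i => simp [Pi.single_apply]

theorem evalHead_shiftAction_rename {n : ℕ} (x : ℤ) (p : MvPolynomial (Fin n) R)
    (f : (Fin (n + 1) → ℤ) → R) :
    evalHead x (shiftAction R (n + 1) (rename Fin.succ p) f) =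
      shiftAction R n p (evalHead x f) := by
  rw [rename_eq_aeval]
  exact (shiftAction_intertwine (evalHead x) (X ∘ Fin.succ)
    (fun s f => by rw [Function.comp_apply, shiftAction_X, evalHead_shiftOp_succ]) p f).symm

/-- Omitting the variable `k_p`. -/
def omitVar {n : ℕ} (p : Fin (n + 1)) : ((Fin n → ℤ) → R) →ₗ[R] ((Fin (n + 1) → ℤ) → R) where
  toFun f := fun k => f (k ∘ p.succAbove)
  map_add' _ _ := rfl
  map_smul' _ _ := rfl

/-- A shift of the omitted variable has no effect, so its indeterminate is specialized to `1`. -/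
theorem shiftAction_omitVar {n : ℕ} (p : Fin (n + 1)) (P : MvPolynomial (Fin (n + 1)) R)
    (f : (Fin n → ℤ) → R) :
    shiftAction R (n + 1) P (omitVar p f) =
      omitVar p (shiftAction R n (aeval (p.insertNth 1 X : Fin (n + 1) → _) P) f) := by
  refine shiftAction_intertwine _ _ (fun s f => ?_) P f
  funext k
  cases s using p.succAboveCases with
  | x =>
    simp only [Fin.insertNth_apply_same, map_one, Module.End.one_apply]
    refine congrArg f (funext fun i => ?_)
    simp
  | p i =>
    simp only [Fin.insertNth_apply_succAbove, shiftAction_X]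
    refine congrArg f (funext fun j => ?_)
    simp [Pi.single_apply]

/-- The product of all difference operators. -/
noncomputable def diffProd (R : Type*) [CommRing R] (n : ℕ) : MvPolynomial (Fin n) R :=
  ∏ i, (X i - 1)

theorem evalHead_diffProd {n : ℕ} (x : ℤ) (f : (Fin (n + 1) → ℤ) → R) :
    evalHead x (shiftAction R (n + 1) (diffProd R (n + 1)) f) =
      shiftAction R n (diffProd R n) (evalHead (x + 1) f - evalHead x f) := by
  have : diffProd R (n + 1) = rename Fin.succ (diffProd R n) * (X 0 - 1) := by
    simp [diffProd, Fin.prod_univ_succ, mul_comm]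
  rw [this, map_mul, Module.End.mul_apply, evalHead_shiftAction_rename]
  simp [evalHead_shiftOp_zero]

/-- The operator by which `pairOp` with the omitted variable `k_p` and `k_i` acts on functions that
do not depend on `k_p`. -/
noncomputable def edgePoly (Q : R) {n : ℕ} (p : Fin (n + 1)) (i : Fin n) :
    MvPolynomial (Fin n) R :=
  if i.castSucc < p then 1 - C (1 - Q) * X i else X i + C (Q - 1)

/-- With `E_p = 1`, the factors for pairs containing `p` become `1 - (1 - Q) E_i` if `p` is the
larger index and `E_i + Q - 1` if it is the smaller one; the other factors form the product in one
variable fewer. -/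
theorem aeval_insertNth_pairProd (Q : R) {n : ℕ} (p : Fin (n + 1)) :
    aeval (p.insertNth 1 X : Fin (n + 1) → MvPolynomial (Fin n) R) (pairProd Q (n + 1)) =
      (∏ i, edgePoly Q p i) * pairProd Q n := by
  have key : ∀ m, pairProd Q m = ∏ s, ∏ t, if s < t then pairPoly Q s t else 1 := fun m => by
    rw [pairProd, Finset.prod_filter, Finset.univ_product_univ.symm, Finset.prod_product]
  rw [key, key, map_prod, Fin.prod_univ_succAbove _ p]
  simp only [map_prod, Fin.prod_univ_succAbove _ p, lt_self_iff_false, if_false, one_mul, map_mul]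
  rw [Finset.prod_mul_distrib, ← mul_assoc, ← Finset.prod_mul_distrib]
  have hC : (C 2 : MvPolynomial (Fin n) R) = 2 := map_ofNat C 2
  congr 1
  · refine Finset.prod_congr rfl fun i _ => ?_
    rcases lt_or_ge i.castSucc p with h | h
    · have h' : p.succAbove i < p := (Fin.succAbove_lt_iff_castSucc_lt p i).2 h
      simp [edgePoly, h, h', h'.not_gt, pairPoly]
      linear_combination (-X i) * hC
    · have h' : p < p.succAbove i := (Fin.lt_succAbove_iff_le_castSucc p i).2 h
      simp [edgePoly, h.not_gt, h', h'.not_gt, pairPoly]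
      linear_combination -hC
  · refine Finset.prod_congr rfl fun i _ => Finset.prod_congr rfl fun j _ => ?_
    simp only [Fin.succAbove_lt_succAbove_iff]
    split_ifs <;> simp [pairPoly]

end ShiftAction

/-! ### Telescoping sums over interlacing rows -/

section InterlacingRows

open MvPolynomial

variable {R : Type*} [CommRing R]

open scoped Classical in
/-- The strictly increasing rows that may stand above the row `k` in a monotone triangle. -/
noncomputable def interlacingRows {n : ℕ} (k : Fin (n + 1) → ℤ) : Finset (Fin n → ℤ) :=
  (Fintype.piFinset fun i => Finset.Icc (k i.castSucc) (k i.succ)).filter StrictMono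

theorem mem_interlacingRows {n : ℕ} {k : Fin (n + 1) → ℤ} {l : Fin n → ℤ} :
    l ∈ interlacingRows k ↔ (∀ i, k i.castSucc ≤ l i ∧ l i ≤ k i.succ) ∧ StrictMono l := by
  simp [interlacingRows]

/-- The weight of an entry `x` with lower neighbours `a` and `b`. -/
def entryWeight (Q : R) (a b x : ℤ) : R := if a < x ∧ x < b then Q else 1

/-- The weight of a row `l` above the row `k`. -/
def rowWeight (Q : R) {n : ℕ} (k : Fin (n + 1) → ℤ) (l : Fin n → ℤ) : R :=
  ∏ i, entryWeight Q (k i.castSucc) (k i.succ) (l i)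

theorem rowWeight_cons (Q : R) {n : ℕ} (k : Fin (n + 2) → ℤ) (x : ℤ) (l : Fin n → ℤ) :
    rowWeight Q k (Fin.cons x l) = entryWeight Q (k 0) (k 1) x * rowWeight Q (Fin.tail k) l := by
  simp [rowWeight, Fin.prod_univ_succ, Fin.tail]

/-- The weighted sum of a function over the rows that may stand above `k`. -/
noncomputable def rowSum (Q : R) {n : ℕ} (k : Fin (n + 1) → ℤ) (F : (Fin n → ℤ) → R) : R :=
  ∑ l ∈ interlacingRows k, rowWeight Q k l * F l

theorem rowSum_zero (Q : R) (k : Fin 1 → ℤ) (F : (Fin 0 → ℤ) → R) :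
    rowSum Q k F = F Fin.elim0 := by
  have : interlacingRows k = {Fin.elim0} := by
    ext l
    simp [mem_interlacingRows, Subsingleton.elim l Fin.elim0, Subsingleton.strictMono]
  simp [rowSum, this, rowWeight]

theorem rowSum_congr (Q : R) {n : ℕ} (k : Fin (n + 1) → ℤ) {F F' : (Fin n → ℤ) → R}
    (h : ∀ l, StrictMono l → F l = F' l) : rowSum Q k F = rowSum Q k F' :=
  Finset.sum_congr rfl fun l hl => by rw [h l (mem_interlacingRows.1 hl).2]

theorem strictMono_tail {n : ℕ} {k : Fin (n + 1) → ℤ} (hk : StrictMono k) :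
    StrictMono (Fin.tail k) := hk.comp (Fin.strictMono_succ)

open scoped Classical in
theorem rowSum_succ (Q : R) {n : ℕ} (k : Fin (n + 2) → ℤ) (F : (Fin (n + 1) → ℤ) → R) :
    rowSum Q k F = ∑ x ∈ Finset.Icc (k 0) (k 1), entryWeight Q (k 0) (k 1) x *
      ∑ l ∈ interlacingRows (Fin.tail k),
        if StrictMono (Fin.cons x l : Fin (n + 1) → ℤ) then
          rowWeight Q (Fin.tail k) l * F (Fin.cons x l) else 0 := by
  simp only [Finset.mul_sum]
  rw [← Finset.sum_product', rowSum]
  simp only [mul_ite, mul_zero]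
  rw [← Finset.sum_filter]
  refine Finset.sum_nbij' (fun l => (l 0, Fin.tail l)) (fun p => Fin.cons p.1 p.2) ?_ ?_ ?_ ?_ ?_
  · intro l hl
    obtain ⟨h1, h2⟩ := mem_interlacingRows.1 hl
    simp only [Finset.mem_filter, Finset.mem_product, Finset.mem_Icc, Fin.cons_self_tail]
    exact ⟨⟨h1 0, mem_interlacingRows.2 ⟨fun i => h1 i.succ, strictMono_tail h2⟩⟩, h2⟩
  · rintro ⟨x, l⟩ h
    simp only [Finset.mem_filter, Finset.mem_product, Finset.mem_Icc] at h
    refine mem_interlacingRows.2 ⟨fun i => ?_, h.2⟩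
    cases i using Fin.cases with
    | zero => exact h.1.1
    | succ i => exact (mem_interlacingRows.1 h.1.2).1 i
  · intro l _
    exact Fin.cons_self_tail l
  · rintro ⟨x, l⟩ _
    simp
  · intro l _
    simp only [Fin.cons_self_tail]
    rw [← mul_assoc, ← rowWeight_cons, Fin.cons_self_tail]

theorem strictMono_cons_iff {n : ℕ} {x : ℤ} {l : Fin (n + 1) → ℤ} :
    StrictMono (Fin.cons x l : Fin (n + 2) → ℤ) ↔ x < l 0 ∧ StrictMono l :=
  strictMono_vecCons

theorem rowSum_one (Q : R) (k : Fin 2 → ℤ) (F : (Fin 1 → ℤ) → R) :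
    rowSum Q k F = ∑ x ∈ Finset.Icc (k 0) (k 1), entryWeight Q (k 0) (k 1) x *
      rowSum Q (Fin.tail k) (evalHead x F) := by
  rw [rowSum_succ]
  refine Finset.sum_congr rfl fun x _ => ?_
  exact congrArg _ (Finset.sum_congr rfl fun l _ => if_pos (Subsingleton.strictMono (α := Fin 1) _))

theorem rowSum_head_eq (Q : R) {n : ℕ} (k : Fin (n + 2) → ℤ) (hk : StrictMono k)
    (F : (Fin (n + 1) → ℤ) → R) :
    rowSum Q k (fun l => if l 0 = k 0 then F l else 0) =
      rowSum Q (Fin.tail k) (evalHead (k 0) F) := by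
  have h01 : k 0 < k 1 := hk (by simp)
  rw [rowSum_succ, Finset.sum_eq_single (k 0)]
  · rw [entryWeight, if_neg (by simp), one_mul]
    refine Finset.sum_congr rfl fun l hl => ?_
    rw [if_pos]
    · simp [evalHead_apply]
    · cases n with
      | zero => exact Subsingleton.strictMono (α := Fin 1) _
      | succ n =>
        obtain ⟨h1, h2⟩ := mem_interlacingRows.1 hl
        exact strictMono_cons_iff.2 ⟨h01.trans_le (h1 0).1, h2⟩
  · intro x _ hx
    simp [hx]
  · simp [h01.le]

/-- Since `x ≤ k 1 ≤ l 0`, strictness between the first two entries fails only for `x = l 0 = k 1`.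
Dropping the condition and subtracting this case leaves a sum in which `x` is independent of `l`;
both entries in the subtracted case have weight `1`. -/
theorem rowSum_succ_succ (Q : R) {n : ℕ} (k : Fin (n + 3) → ℤ) (hk : StrictMono k)
    (F : (Fin (n + 2) → ℤ) → R) :
    rowSum Q k F = (∑ x ∈ Finset.Icc (k 0) (k 1), entryWeight Q (k 0) (k 1) x *
        rowSum Q (Fin.tail k) (evalHead x F)) -
      rowSum Q (Fin.tail (Fin.tail k)) (evalHead (k 1) (evalHead (k 1) F)) := by
  have h01 : k 0 < k 1 := hk (by simp)
  have hend : ∑ x ∈ Finset.Icc (k 0) (k 1), entryWeight Q (k 0) (k 1) x *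
      (if x = k 1 then rowSum Q (Fin.tail k)
        (fun l => if l 0 = k 1 then evalHead x F l else 0) else 0) =
      rowSum Q (Fin.tail (Fin.tail k)) (evalHead (k 1) (evalHead (k 1) F)) := by
    rw [Finset.sum_eq_single (k 1)]
    · rw [entryWeight, if_neg (by simp), one_mul, if_pos rfl]
      exact rowSum_head_eq Q _ (strictMono_tail hk) _
    · intro x _ hx
      simp [hx]
    · simp [h01.le]
  rw [← hend, ← Finset.sum_sub_distrib, rowSum_succ]
  refine Finset.sum_congr rfl fun x hx => ?_
  rw [← mul_sub]
  congr 1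
  rw [Finset.mem_Icc] at hx
  by_cases hx1 : x = k 1
  · rw [if_pos hx1, rowSum, rowSum, ← Finset.sum_sub_distrib]
    refine Finset.sum_congr rfl fun l hl => ?_
    obtain ⟨h1, h2⟩ := mem_interlacingRows.1 hl
    have h10 : k 1 ≤ l 0 := (h1 0).1
    by_cases hl0 : l 0 = k 1
    · rw [if_neg fun h => ?_, if_pos hl0, sub_self]
      have := (strictMono_cons_iff.1 h).1
      omega
    · rw [if_pos (strictMono_cons_iff.2 ⟨by omega, h2⟩), if_neg hl0, mul_zero, sub_zero]
      rfl
  · rw [if_neg hx1, sub_zero]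
    refine Finset.sum_congr rfl fun l hl => ?_
    obtain ⟨h1, h2⟩ := mem_interlacingRows.1 hl
    have h10 : k 1 ≤ l 0 := (h1 0).1
    rw [if_pos (strictMono_cons_iff.2 ⟨by omega, h2⟩)]
    rfl

theorem sum_Icc_int_sub (g : ℤ → R) {a b : ℤ} (h : a ≤ b) :
    ∑ x ∈ Finset.Icc a b, (g (x + 1) - g x) = g (b + 1) - g a := by
  induction b, h using Int.leInduction with
  | base => simp
  | succ b h ih =>
    have : Finset.Icc a (b + 1) = insert (b + 1) (Finset.Icc a b) := by
      ext x; simp only [Finset.mem_Icc, Finset.mem_insert]; omega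
    rw [this, Finset.sum_insert (by simp), ih]
    ring

theorem sum_entryWeight_mul_sub (Q : R) (g : ℤ → R) {a b : ℤ} (h : a < b) :
    ∑ x ∈ Finset.Icc a b, entryWeight Q a b x * (g (x + 1) - g x) =
      (g (b + 1) + (Q - 1) * g b) - (g a - (1 - Q) * g (a + 1)) := by
  -- Every `x` gets weight `Q`, and each endpoint an extra `1 - Q`; the endpoints are distinct
  -- because `a < b`.
  have hw : ∀ x ∈ Finset.Icc a b, entryWeight Q a b x * (g (x + 1) - g x) =
      Q * (g (x + 1) - g x) + ((if x = a then (1 - Q) * (g (x + 1) - g x) else 0) +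
        (if x = b then (1 - Q) * (g (x + 1) - g x) else 0)) := by
    intro x hx
    rw [Finset.mem_Icc] at hx
    rw [entryWeight]
    split_ifs <;> first | omega | ring
  rw [Finset.sum_congr rfl hw, Finset.sum_add_distrib, ← Finset.mul_sum, sum_Icc_int_sub g h.le,
    Finset.sum_add_distrib, Finset.sum_ite_eq' , Finset.sum_ite_eq',
    if_pos (by simp [h.le]), if_pos (by simp [h.le])]
  ring

theorem rowSum_add (Q : R) {n : ℕ} (k : Fin (n + 1) → ℤ) (F F' : (Fin n → ℤ) → R) :
    rowSum Q k (F + F') = rowSum Q k F + rowSum Q k F' := by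
  simp [rowSum, mul_add, Finset.sum_add_distrib]

theorem rowSum_smul (Q : R) {n : ℕ} (k : Fin (n + 1) → ℤ) (c : R) (F : (Fin n → ℤ) → R) :
    rowSum Q k (c • F) = c * rowSum Q k F := by
  simp only [rowSum, Finset.mul_sum, Pi.smul_apply, smul_eq_mul]
  exact Finset.sum_congr rfl fun _ _ => by ring

/-- `rowSum` as a linear functional. -/
noncomputable def rowSumLinear (Q : R) {n : ℕ} (k : Fin (n + 1) → ℤ) :
    ((Fin n → ℤ) → R) →ₗ[R] R where
  toFun := rowSum Q k
  map_add' := rowSum_add Q k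
  map_smul' := rowSum_smul Q k

/-- The alternating sum over `p` of the values at `k` without `k_p` of the function obtained by
applying `id - (1 - Q) E` in the variables before `k_p` and `E + Q - 1` in those after it. -/
noncomputable def alternatingSum (Q : R) {n : ℕ} (k : Fin (n + 1) → ℤ) :
    ((Fin n → ℤ) → R) →ₗ[R] R :=
  ∑ p : Fin (n + 1), (-1 : R) ^ (p : ℕ) •
    LinearMap.proj (k ∘ p.succAbove) ∘ₗ shiftAction R n (∏ i, edgePoly Q p i)

theorem alternatingSum_apply (Q : R) {n : ℕ} (k : Fin (n + 1) → ℤ) (f : (Fin n → ℤ) → R) :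
    alternatingSum Q k f = ∑ p : Fin (n + 1), (-1 : R) ^ (p : ℕ) *
      shiftAction R n (∏ i, edgePoly Q p i) f (k ∘ p.succAbove) := by
  simp [alternatingSum]

/-- The operator `E + Q - 1` with respect to the first variable, at `x`. -/
def rightEdge (Q : R) {n : ℕ} (x : ℤ) : ((Fin (n + 1) → ℤ) → R) →ₗ[R] ((Fin n → ℤ) → R) :=
  evalHead (x + 1) + (Q - 1) • evalHead x

/-- The operator `id - (1 - Q) E` with respect to the first variable, at `x`. -/
def leftEdge (Q : R) {n : ℕ} (x : ℤ) : ((Fin (n + 1) → ℤ) → R) →ₗ[R] ((Fin n → ℤ) → R) :=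
  evalHead x - (1 - Q) • evalHead (x + 1)

theorem rightProd_succ (Q : R) {n : ℕ} (k : Fin (n + 1) → ℤ) (f : (Fin (n + 1) → ℤ) → R) :
    shiftAction R (n + 1) (∏ i, (X i + C (Q - 1))) f k =
      shiftAction R n (∏ i, (X i + C (Q - 1))) (rightEdge Q (k 0) f) (Fin.tail k) := by
  have : (∏ i : Fin (n + 1), (X i + C (Q - 1)) : MvPolynomial (Fin (n + 1)) R) =
      rename Fin.succ (∏ i : Fin n, (X i + C (Q - 1))) * (X 0 + C (Q - 1)) := by
    simp only [Fin.prod_univ_succ, map_prod, map_add, rename_X, rename_C, mul_comm]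
  conv_lhs => rw [← Fin.cons_self_tail k]
  rw [← evalHead_apply (k 0) (shiftAction R _ _ f), this, map_mul, Module.End.mul_apply, evalHead_shiftAction_rename]
  simp only [map_add, shiftAction_X, shiftAction_C, LinearMap.add_apply, evalHead_shiftOp_zero,
    LinearMap.smul_apply, Module.End.one_apply, map_smul, rightEdge]

/-- The term `p = 0` omits `k 0`, so all its operators are of the right-edge type. In every other
term `k 0` comes before `k_p` and contributes a left-edge operator, with the sign shifted by one. -/
theorem alternatingSum_succ (Q : R) {n : ℕ} (k : Fin (n + 2) → ℤ)
    (f : (Fin (n + 1) → ℤ) → R) :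
    alternatingSum Q k f = shiftAction R (n + 1) (∏ i, (X i + C (Q - 1))) f (Fin.tail k) -
      alternatingSum Q (Fin.tail k) (leftEdge Q (k 0) f) := by
  rw [alternatingSum_apply, alternatingSum_apply, Fin.sum_univ_succ, sub_eq_add_neg,
    ← Finset.sum_neg_distrib]
  congr 1
  · simp [edgePoly]
    rfl
  · refine Finset.sum_congr rfl fun q _ => ?_
    have hp : (∏ i, edgePoly Q q.succ i : MvPolynomial (Fin (n + 1)) R) =
        rename Fin.succ (∏ i, edgePoly Q q i) * (1 - C (1 - Q) * X 0) := by
      rw [Fin.prod_univ_succ, mul_comm, map_prod]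
      congr 1
      refine Finset.prod_congr rfl fun i _ => ?_
      rw [edgePoly, edgePoly, ← Fin.succ_castSucc]
      simp only [Fin.succ_lt_succ_iff]
      split_ifs <;> simp
    have hk : k ∘ q.succ.succAbove = Fin.cons (k 0) (Fin.tail k ∘ q.succAbove) := by
      funext i
      cases i using Fin.cases <;> simp [Fin.tail]
    rw [hk, ← evalHead_apply (k 0) (shiftAction R _ _ f), hp, map_mul, Module.End.mul_apply,
      evalHead_shiftAction_rename]
    simp only [map_sub, map_mul, map_one, shiftAction_X, shiftAction_C, LinearMap.sub_apply,
      evalHead_shiftOp_zero, LinearMap.smul_apply, Module.End.one_apply, Module.End.mul_apply,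
      map_smul, leftEdge, Fin.val_succ, pow_succ, Pi.sub_apply, Pi.smul_apply, smul_eq_mul]
    ring

/-- Wherever two neighbouring variables agree, `pairOp` with these variables in reverse order
vanishes. -/
def VanishesOnDiagonals (Q : R) {n : ℕ} (f : (Fin n → ℤ) → R) : Prop :=
  ∀ (i j : Fin n), (j : ℕ) = i + 1 → ∀ l : Fin n → ℤ, l i = l j → pairOp Q j i f l = 0

namespace VanishesOnDiagonals

theorem add {Q : R} {n : ℕ} {f g : (Fin n → ℤ) → R} (hf : VanishesOnDiagonals Q f)
    (hg : VanishesOnDiagonals Q g) : VanishesOnDiagonals Q (f + g) := fun i j h l hl => by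
  rw [map_add, Pi.add_apply, hf i j h l hl, hg i j h l hl, add_zero]

theorem smul {Q : R} {n : ℕ} {f : (Fin n → ℤ) → R} (c : R) (hf : VanishesOnDiagonals Q f) :
    VanishesOnDiagonals Q (c • f) := fun i j h l hl => by
  rw [map_smul, Pi.smul_apply, hf i j h l hl, smul_zero]

theorem sub {Q : R} {n : ℕ} {f g : (Fin n → ℤ) → R} (hf : VanishesOnDiagonals Q f)
    (hg : VanishesOnDiagonals Q g) : VanishesOnDiagonals Q (f - g) := fun i j h l hl => by
  rw [map_sub, Pi.sub_apply, hf i j h l hl, hg i j h l hl, sub_zero]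

theorem evalHead {Q : R} {n : ℕ} {f : (Fin (n + 1) → ℤ) → R} (hf : VanishesOnDiagonals Q f)
    (x : ℤ) : VanishesOnDiagonals Q (evalHead x f) := fun i j h l hl => by
  have := hf i.succ j.succ (by simp [h]) (Fin.cons x l) (by simpa using hl)
  rw [← shiftAction_pairPoly] at this ⊢
  rw [← evalHead_shiftAction_rename, evalHead_apply]
  simpa [pairPoly] using this

theorem head {Q : R} {n : ℕ} {f : (Fin (n + 2) → ℤ) → R} (hf : VanishesOnDiagonals Q f)
    (x : ℤ) : _root_.evalHead x (_root_.evalHead x f) -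
      (2 - Q) • _root_.evalHead (x + 1) (_root_.evalHead x f) +
      _root_.evalHead (x + 1) (_root_.evalHead (x + 1) f) = 0 := by
  funext l
  have h := hf 0 1 (by simp) (Fin.cons x (Fin.cons x l)) (by simp)
  change _root_.evalHead x (_root_.evalHead x (pairOp Q 1 0 f)) l = 0 at h
  have h1 : (1 : Fin (n + 2)) = Fin.succ 0 := rfl
  rw [h1] at h
  rw [Pi.zero_apply]
  simpa only [pairOp, LinearMap.add_apply, LinearMap.sub_apply, LinearMap.smul_apply, map_add,
    map_sub, map_smul, Module.End.one_apply, Module.End.mul_apply, evalHead_shiftOp_succ,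
    evalHead_shiftOp_zero] using h

theorem rightEdge {Q : R} {n : ℕ} {f : (Fin (n + 1) → ℤ) → R} (hf : VanishesOnDiagonals Q f)
    (x : ℤ) : VanishesOnDiagonals Q (rightEdge Q x f) :=
  (hf.evalHead (x + 1)).add ((hf.evalHead x).smul (Q - 1))

theorem leftEdge {Q : R} {n : ℕ} {f : (Fin (n + 1) → ℤ) → R} (hf : VanishesOnDiagonals Q f)
    (x : ℤ) : VanishesOnDiagonals Q (leftEdge Q x f) :=
  (hf.evalHead x).sub ((hf.evalHead (x + 1)).smul (1 - Q))

end VanishesOnDiagonals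

theorem sum_entryWeight_mul_rowSum (Q : R) {n : ℕ} (k : Fin (n + 1) → ℤ) {a b : ℤ} (h : a < b)
    (f : (Fin (n + 1) → ℤ) → R) :
    ∑ x ∈ Finset.Icc a b, entryWeight Q a b x *
        rowSum Q k (evalHead x (shiftAction R (n + 1) (diffProd R (n + 1)) f)) =
      rowSum Q k (shiftAction R n (diffProd R n) (rightEdge Q b f)) -
        rowSum Q k (shiftAction R n (diffProd R n) (leftEdge Q a f)) := by
  have := sum_entryWeight_mul_sub Q
    (fun x => rowSumLinear Q k (shiftAction R n (diffProd R n) (evalHead x f))) h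
  change ∑ x ∈ Finset.Icc a b, entryWeight Q a b x * rowSumLinear Q k _ =
    rowSumLinear Q k _ - rowSumLinear Q k _
  simpa only [evalHead_diffProd, rightEdge, leftEdge, map_add, map_sub, LinearMap.add_apply,
    LinearMap.sub_apply, LinearMap.smul_apply, map_smul, smul_eq_mul] using this

/-- The weighted sum over the rows above `k` of a repeated difference. -/
theorem rowSum_diffProd (Q : R) : ∀ {n : ℕ} (k : Fin (n + 1) → ℤ), StrictMono k →
    ∀ f : (Fin n → ℤ) → R, VanishesOnDiagonals Q f →
      rowSum Q k (shiftAction R n (diffProd R n) f) = alternatingSum Q k f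
  | 0, k, _, f, _ => by
    rw [rowSum_zero, alternatingSum_apply]
    rw [Fin.sum_univ_one]
    simp only [diffProd, Finset.univ_eq_empty, Finset.prod_empty, map_one, Module.End.one_apply,
      Fin.val_zero, pow_zero, one_mul]
    exact congrArg f (Subsingleton.elim _ _)
  | 1, k, hk, f, hf => by
    rw [rowSum_one, sum_entryWeight_mul_rowSum Q _ (hk (by simp)),
      rowSum_diffProd Q _ (strictMono_tail hk) _ (hf.leftEdge _), alternatingSum_succ,
      rightProd_succ, rowSum_zero]
    congr 1
    simp only [diffProd, Finset.univ_eq_empty, Finset.prod_empty, map_one, Module.End.one_apply]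
    exact congrArg _ (Subsingleton.elim _ _)
  | n + 2, k, hk, f, hf => by
    -- Expanding the edge operators and the double difference at `k 1` gives exactly `Q` times the
    -- expression in `VanishesOnDiagonals.head`.
    have hzero : leftEdge Q (k 1) (rightEdge Q (k 1) f) +
        (evalHead (k 1 + 1) (evalHead (k 1 + 1) f - evalHead (k 1) f) -
          evalHead (k 1) (evalHead (k 1 + 1) f - evalHead (k 1) f)) = 0 := by
      have h := congrArg (Q • ·) (hf.head (k 1))
      rw [smul_zero] at h
      rw [← h]
      simp only [leftEdge, rightEdge, LinearMap.add_apply, LinearMap.sub_apply,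
        LinearMap.smul_apply, map_add, map_sub, map_smul]
      module
    have hd := fun x => hf.evalHead x
    have hdd := (hd (k 1 + 1)).sub (hd (k 1))
    rw [rowSum_succ_succ Q k hk, sum_entryWeight_mul_rowSum Q _ (hk (by simp)),
      rowSum_diffProd Q _ (strictMono_tail hk) _ (hf.leftEdge _),
      rowSum_diffProd Q _ (strictMono_tail hk) _ (hf.rightEdge _), evalHead_diffProd,
      evalHead_diffProd, rowSum_diffProd Q _ (strictMono_tail (strictMono_tail hk)) _
        ((hdd.evalHead _).sub (hdd.evalHead _)),
      alternatingSum_succ Q (Fin.tail k) (rightEdge Q (k 1) f), alternatingSum_succ Q k f,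
      rightProd_succ Q (Fin.tail k) f]
    -- The surplus consists of the `leftEdge`-`rightEdge` term at `k 1`, from expanding the right
    -- boundary, and the strictness correction; by `hzero` they cancel.
    have h0 := congrArg (alternatingSum Q (Fin.tail (Fin.tail k))) hzero
    rw [map_add, map_zero] at h0
    have ht : Fin.tail k 0 = k 1 := rfl
    rw [ht]
    linear_combination -h0

end InterlacingRows

/-! ### The binomial determinant and its symmetries -/

section BinomialDeterminant

open MvPolynomial

variable {R : Type*} [CommRing R]

/-- The determinant of the binomial coefficients `(k_i choose j + d)`. -/
noncomputable def binomDet (R : Type*) [CommRing R] (d n : ℕ) (k : Fin n → ℤ) : R :=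
  (Matrix.of fun j i : Fin n => ((Ring.choose (k i) ((j : ℕ) + d) : ℤ) : R)).det

theorem binomDet_comp (d : ℕ) {n : ℕ} (σ : Equiv.Perm (Fin n)) (k : Fin n → ℤ) :
    binomDet R d n (k ∘ σ) = Equiv.Perm.sign σ * binomDet R d n k :=
  Matrix.det_permute' σ (Matrix.of fun j i : Fin n => ((Ring.choose (k i) ((j : ℕ) + d) : ℤ) : R))

/-- Laplace expansion along the row `(k_i choose 0) = 1`; in the minors the lower indices start at
`1`. -/
theorem binomDet_zero_succ (n : ℕ) :
    binomDet R 0 (n + 1) = ∑ p : Fin (n + 1), (-1 : R) ^ (p : ℕ) • omitVar p (binomDet R 1 n) := by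
  funext k
  rw [binomDet, Matrix.det_succ_row_zero, Finset.sum_apply]
  refine Finset.sum_congr rfl fun p _ => ?_
  simp only [Matrix.of_apply, Fin.val_zero, add_zero, Ring.choose_zero_right, Int.cast_one, mul_one]
  rfl

theorem shiftAction_prod_diff {n : ℕ} (g : Fin n → ℤ → R) (s : Finset (Fin n)) :
    shiftAction R n (∏ i ∈ s, (X i - 1)) (fun k => ∏ i, g i (k i)) =
      fun k => ∏ i, if i ∈ s then g i (k i + 1) - g i (k i) else g i (k i) := by
  induction s using Finset.induction_on with
  | empty => simp
  | insert a s ha ih =>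
    rw [Finset.prod_insert ha, map_mul, Module.End.mul_apply, ih, map_sub, map_one, shiftAction_X]
    funext k
    let k' : Fin n → ℤ := k + Pi.single a 1
    change (∏ i, if i ∈ s then g i (k' i + 1) - g i (k' i) else g i (k' i)) - (∏ i, if i ∈ s then g i (k i + 1) - g i (k i)
      else g i (k i)) = _
    rw [← Finset.mul_prod_erase _ _ (Finset.mem_univ a),
      ← Finset.mul_prod_erase _ _ (Finset.mem_univ a),
      ← Finset.mul_prod_erase _ _ (Finset.mem_univ a), if_neg ha, if_neg ha,
      if_pos (Finset.mem_insert_self a s), sub_mul]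
    congr 2
    · simp [k']
    · refine Finset.prod_congr rfl fun i hi => ?_
      have hia := Finset.ne_of_mem_erase hi
      simp [hia, k']
    · refine Finset.prod_congr rfl fun i hi => ?_
      have hia := Finset.ne_of_mem_erase hi
      simp [hia]

/-- In the Leibniz expansion each variable occurs in one factor, and Pascal's rule lowers each lower
index by one. -/
theorem shiftAction_diffProd_binomDet (d n : ℕ) :
    shiftAction R n (diffProd R n) (binomDet R (d + 1) n) = binomDet R d n := by
  have hdet : ∀ d, binomDet R d n = ∑ σ : Equiv.Perm (Fin n), ((Equiv.Perm.sign σ : ℤ) : R) •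
      fun k : Fin n → ℤ => ∏ i, ((Ring.choose (k i) ((σ i : ℕ) + d) : ℤ) : R) := by
    intro d
    funext k
    rw [binomDet, Matrix.det_apply', Finset.sum_apply]
    rfl
  rw [hdet, hdet, map_sum]
  refine Finset.sum_congr rfl fun σ _ => ?_
  rw [map_smul, diffProd, shiftAction_prod_diff
    (fun i x => ((Ring.choose x ((σ i : ℕ) + (d + 1)) : ℤ) : R))]
  congr 1
  funext k
  refine Finset.prod_congr rfl fun i _ => ?_
  rw [if_pos (Finset.mem_univ i), ← add_assoc, Ring.choose_succ_succ]
  push_cast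
  ring

/-- The polynomial `j! (x choose j)` is monic of degree `j`, so these polynomials give the same
determinant as the powers of `x`. -/
theorem superFactorial_mul_binomDet (n : ℕ) (k : Fin n → ℤ) :
    (∏ j : Fin n, ((j : ℕ).factorial : ℤ)) * binomDet ℤ 0 n k = (Matrix.vandermonde k).det := by
  rw [Matrix.det_eval_matrixOfPolynomials_eq_det_vandermonde k (fun j => descPochhammer ℤ j)
    (fun j => descPochhammer_natDegree ℤ j) (fun j => monic_descPochhammer ℤ j), binomDet,
    ← Matrix.det_transpose, ← Matrix.det_mul_row]
  congr 1
  ext i j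
  simp only [Matrix.of_apply, Matrix.transpose_apply, add_zero, Int.cast_id]
  have := Ring.descPochhammer_eq_factorial_smul_choose (k i) j
  rw [nsmul_eq_mul] at this
  rw [← this, Polynomial.eval_eq_smeval]

theorem vandermondeQuotient_eq_binomDet (R : Type*) [CommRing R] [Algebra ℚ R] (n : ℕ) :
    vandermondeQuotient R n = binomDet R 0 n := by
  have key : ∀ v : Fin n → ℤ, ∏ p : Fin n × Fin n with p.1 < p.2, (v p.2 - v p.1) =
      (∏ j : Fin n, ((j : ℕ).factorial : ℤ)) * binomDet ℤ 0 n v := by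
    intro v
    rw [superFactorial_mul_binomDet, Matrix.det_vandermonde, Finset.prod_filter,
      Finset.univ_product_univ.symm, Finset.prod_product]
    refine Finset.prod_congr rfl fun i _ => ?_
    rw [← Finset.prod_filter]
    exact Finset.prod_congr (by ext; simp) fun _ _ => rfl
  -- At `k_i = i` the matrix is unitriangular; this identifies the denominator `∏ (j - i)` with the
  -- product of factorials.
  have hid : binomDet ℤ 0 n (fun i => ((i : ℕ) : ℤ)) = 1 := by
    rw [binomDet, Matrix.det_of_isUpperTriangular]
    · simp [Ring.choose_natCast]
    · intro i j hij
      have : (j : ℕ) < i := hij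
      simp [Ring.choose_natCast, Nat.choose_eq_zero_of_lt this]
  funext k
  have hcast : binomDet R 0 n k = algebraMap ℚ R ((binomDet ℤ 0 n k : ℤ) : ℚ) := by
    rw [map_intCast, binomDet, binomDet]
    exact (RingHom.map_det (Int.castRingHom R) _).symm
  rw [hcast, vandermondeQuotient, ← map_prod, Finset.prod_div_distrib]
  congr 1
  have h1 := congrArg (Int.cast : ℤ → ℚ) (key k)
  have h2 := congrArg (Int.cast : ℤ → ℚ) (key fun i => ((i : ℕ) : ℤ))
  rw [hid] at h2
  push_cast at h1 h2
  rw [h1, h2, mul_one]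
  refine mul_div_cancel_left₀ _ ?_
  exact Finset.prod_ne_zero_iff.2 fun j _ => by exact_mod_cast (Nat.factorial_pos _).ne'

/-- As `i` and `j` are adjacent, swapping them preserves the order of every other pair, while the
factors for `(i, j)` and `(j, i)` are exchanged. -/
theorem rename_swap_pairProd (Q : R) {n : ℕ} {i j : Fin n} (hij : (j : ℕ) = i + 1) :
    rename (Equiv.swap i j) (pairPoly Q j i * pairProd Q n) = pairPoly Q j i * pairProd Q n := by
  have hlt : i < j := by rw [Fin.lt_def]; omega
  have hren : ∀ s t, rename (Equiv.swap i j) (pairPoly Q s t) =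
      pairPoly Q (Equiv.swap i j s) (Equiv.swap i j t) := fun s t => by simp [pairPoly]
  have hmem : (i, j) ∈ (Finset.univ.filter fun p : Fin n × Fin n => p.1 < p.2) := by simp [hlt]
  have hrest : rename (Equiv.swap i j) (∏ p ∈ (Finset.univ.filter
      fun p : Fin n × Fin n => p.1 < p.2).erase (i, j), pairPoly Q p.1 p.2) =
      ∏ p ∈ (Finset.univ.filter
        fun p : Fin n × Fin n => p.1 < p.2).erase (i, j), pairPoly Q p.1 p.2 := by
    have hmaps : ∀ s t : Fin n, (s, t) ≠ (i, j) → s < t →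
        (Equiv.swap i j s, Equiv.swap i j t) ≠ (i, j) ∧
          Equiv.swap i j s < Equiv.swap i j t := by
      intro s t hne hst
      simp only [Equiv.swap_apply_def, ne_eq, Prod.mk.injEq, Fin.ext_iff, Fin.lt_def] at *
      split_ifs <;> simp_all <;> omega
    rw [map_prod]
    refine Finset.prod_nbij' (fun p => (Equiv.swap i j p.1, Equiv.swap i j p.2))
      (fun p => (Equiv.swap i j p.1, Equiv.swap i j p.2)) ?_ ?_ ?_ ?_ ?_
    · rintro ⟨s, t⟩ h
      simp only [Finset.mem_erase, Finset.mem_filter, Finset.mem_univ, true_and] at h ⊢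
      exact hmaps s t h.1 h.2
    · rintro ⟨s, t⟩ h
      simp only [Finset.mem_erase, Finset.mem_filter, Finset.mem_univ, true_and] at h ⊢
      exact hmaps s t h.1 h.2
    · rintro ⟨s, t⟩ _
      simp
    · rintro ⟨s, t⟩ _
      simp
    · rintro ⟨s, t⟩ _
      exact hren s t
  rw [pairProd, ← Finset.mul_prod_erase _ _ hmem, map_mul, map_mul, hrest, hren, hren,
    Equiv.swap_apply_left, Equiv.swap_apply_right, mul_left_comm]

/-- Permuting the variables. -/
def permVars {n : ℕ} (σ : Equiv.Perm (Fin n)) :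
    ((Fin n → ℤ) → R) →ₗ[R] ((Fin n → ℤ) → R) where
  toFun f := fun k => f (k ∘ σ)
  map_add' _ _ := rfl
  map_smul' _ _ := rfl

theorem shiftAction_permVars_swap {n : ℕ} (i j : Fin n) (P : MvPolynomial (Fin n) R)
    (f : (Fin n → ℤ) → R) :
    shiftAction R n P (permVars (Equiv.swap i j) f) =
      permVars (Equiv.swap i j) (shiftAction R n (rename (Equiv.swap i j) P) f) := by
  rw [rename_eq_aeval]
  refine shiftAction_intertwine _ _ (fun s f => ?_) P f
  rw [Function.comp_apply, shiftAction_X]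
  funext k
  refine congrArg f (funext fun t => ?_)
  simp [Pi.single_apply, ← Equiv.swap_apply_eq_iff]

theorem vanishesOnDiagonals_pairProd_binomDet [Algebra ℚ R] (Q : R) (d n : ℕ) :
    VanishesOnDiagonals Q (shiftAction R n (pairProd Q n) (binomDet R d n)) := by
  intro i j hij l hl
  have hne : i ≠ j := fun h => by rw [h] at hij; omega
  rw [← shiftAction_pairPoly, ← Module.End.mul_apply, ← map_mul]
  have h := congrFun (shiftAction_permVars_swap i j (pairPoly Q j i * pairProd Q n)
    (binomDet R d n)) l
  have hanti : permVars (Equiv.swap i j) (binomDet R d n) = -binomDet R d n := by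
    funext k
    exact (binomDet_comp d _ k).trans (by simp [Equiv.Perm.sign_swap hne])
  have hl' : l ∘ Equiv.swap i j = l := by
    funext t
    simp only [Function.comp_apply, Equiv.swap_apply_def]
    split_ifs with h1 h2
    · rw [h1, hl]
    · rw [h2, hl]
    · rfl
  rw [rename_swap_pairProd Q hij, hanti, map_neg] at h
  change -_ = shiftAction R n _ _ (l ∘ Equiv.swap i j) at h
  rw [hl'] at h
  -- Antisymmetry at a point fixed by the swap makes the value its own negative; `2` is invertible
  -- in a `ℚ`-algebra.
  have h2 : (2 : R) * shiftAction R n (pairPoly Q j i * pairProd Q n) (binomDet R d n) l = 0 := by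
    linear_combination -h
  have hu : algebraMap ℚ R (1 / 2) * 2 = 1 := by
    rw [← map_ofNat (algebraMap ℚ R) 2, ← map_mul]
    norm_num
  rw [← one_mul (shiftAction R n _ _ l), ← hu, mul_assoc, h2, mul_zero]

theorem alternatingSum_pairProd_binomDet (Q : R) {n : ℕ} (k : Fin (n + 1) → ℤ) :
    alternatingSum Q k (shiftAction R n (pairProd Q n) (binomDet R 1 n)) =
      shiftAction R (n + 1) (pairProd Q (n + 1)) (binomDet R 0 (n + 1)) k := by
  rw [alternatingSum_apply, binomDet_zero_succ, map_sum, Finset.sum_apply]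
  refine Finset.sum_congr rfl fun p _ => ?_
  rw [map_smul, shiftAction_omitVar, aeval_insertNth_pairProd, ← Module.End.mul_apply, ← map_mul]
  rfl

end BinomialDeterminant

/-! ### Removing the bottom row of a monotone triangle -/

namespace MonotoneTriangle

/-- The triangle above the bottom row. -/
def removeBottom {n : ℕ} (T : MonotoneTriangle (n + 1)) : MonotoneTriangle n where
  entry i j := T.entry (i + 1) (j + 1)
  northeast i j hi hj := T.northeast (i + 1) (j + 1) (by omega) (by omega)
  southeast i j hi hj := T.southeast (i + 1) (j + 1) (by omega) (by omega)
  row_strict i j hi hj := T.row_strict (i + 1) (j + 1) (by omega) (by omega)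
  zeros i j h := T.zeros (i + 1) (j + 1) (by omega)

/-- The entries of the triangle `T` with the row `k` put below it. -/
def addBottomEntry {n : ℕ} (T : MonotoneTriangle n) (k : Fin (n + 1) → ℤ) : ℕ → ℕ → ℤ
  | 0, j => if h : j < n + 1 then k ⟨j, h⟩ else 0
  | _ + 1, 0 => 0
  | i + 1, j + 1 => T.entry i j

/-- The triangle `T` with the row `k` put below it. -/
def addBottom {n : ℕ} (T : MonotoneTriangle n) (k : Fin (n + 1) → ℤ) (hk : StrictMono k)
    (h : T.bottomRow ∈ interlacingRows k) : MonotoneTriangle (n + 1) where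
  entry := addBottomEntry T k
  northeast
    | 0, j, _, hj => by
      have := ((mem_interlacingRows.1 h).1 ⟨j, by omega⟩).1
      simpa [addBottomEntry, bottomRow, show j < n + 1 by omega] using this
    | i + 1, 0, hi, _ => by omega
    | i + 1, j + 1, hi, hj => T.northeast i j (by omega) (by omega)
  southeast
    | 0, 0, hi, _ => by omega
    | 0, j + 1, _, hj => by
      have := ((mem_interlacingRows.1 h).1 ⟨j, by omega⟩).2
      simpa [addBottomEntry, bottomRow, show j < n by omega] using this
    | i + 1, 0, hi, _ => by omega
    | i + 1, j + 1, hi, hj => T.southeast i j (by omega) (by omega)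
  row_strict
    | 0, j, _, hj => by
      have : k ⟨j, by omega⟩ < k ⟨j + 1, hj⟩ := hk (by simp [Fin.lt_def])
      simpa [addBottomEntry, show j < n + 1 by omega, show j < n by omega] using this
    | i + 1, 0, hi, _ => by omega
    | i + 1, j + 1, hi, hj => T.row_strict i j (by omega) (by omega)
  zeros
    | 0, j, hj => by simp only [addBottomEntry]; rw [dif_neg (by omega)]
    | i + 1, 0, _ => rfl
    | i + 1, j + 1, hj => T.zeros i j (by omega)

theorem bottomRow_addBottom {n : ℕ} (T : MonotoneTriangle n) (k : Fin (n + 1) → ℤ)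
    (hk : StrictMono k) (h : T.bottomRow ∈ interlacingRows k) :
    (T.addBottom k hk h).bottomRow = k := by
  funext j
  exact dif_pos j.2

theorem mem_withBottomRow {n : ℕ} {k : Fin n → ℤ} {T : MonotoneTriangle n} :
    T ∈ withBottomRow k ↔ T.bottomRow = k := by
  simp [withBottomRow]

theorem removeBottom_injOn {n : ℕ} {T T' : MonotoneTriangle (n + 1)}
    (hb : T.bottomRow = T'.bottomRow) (h : T.removeBottom = T'.removeBottom) : T = T' := by
  ext i j
  by_cases hij : i ≤ j ∧ j < n + 1
  · match i, j with
    | 0, j => exact congrFun hb ⟨j, hij.2⟩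
    | i + 1, 0 => omega
    | i + 1, j + 1 => exact congrArg (fun S => S.entry i j) h
  · rw [T.zeros i j hij, T'.zeros i j hij]

theorem bottomRow_removeBottom_mem {n : ℕ} (T : MonotoneTriangle (n + 1)) :
    T.removeBottom.bottomRow ∈ interlacingRows T.bottomRow := by
  refine mem_interlacingRows.2 ⟨fun i => ⟨?_, ?_⟩, ?_⟩
  · exact T.northeast 0 i (by omega) (by omega)
  · exact T.southeast 0 (i + 1) (by omega) (by omega)
  · cases n with
    | zero => exact fun i => i.elim0
    | succ n =>
      exact Fin.strictMono_iff_lt_succ.2 fun i =>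
        T.row_strict 1 (i + 1) (by omega) (by omega)

theorem pow_numStrictlyBetween {R : Type*} [CommRing R] (Q : R) {n : ℕ}
    (T : MonotoneTriangle (n + 1)) :
    Q ^ T.numStrictlyBetween = rowWeight Q T.bottomRow T.removeBottom.bottomRow *
      Q ^ T.removeBottom.numStrictlyBetween := by
  have hrow : rowWeight Q T.bottomRow T.removeBottom.bottomRow =
      Q ^ (∑ j ∈ Finset.range n,
        if T.entry 0 j < T.entry 1 (j + 1) ∧ T.entry 1 (j + 1) < T.entry 0 (j + 1)
        then 1 else 0) := by
    rw [← Finset.prod_pow_eq_pow_sum, Finset.prod_range, rowWeight]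
    refine Finset.prod_congr rfl fun i _ => ?_
    rw [entryWeight]
    simp only [bottomRow, removeBottom, Fin.val_castSucc, Fin.val_succ, zero_add]
    split_ifs <;> simp
  rw [hrow, ← pow_add]
  congr 1
  rw [numStrictlyBetween, numStrictlyBetween, Finset.card_filter, Finset.card_filter,
    Finset.sum_product, Finset.sum_product, Finset.sum_range_succ', add_comm]
  congr 1
  -- The row has `n + 1` entries but only `n` gaps, so the last index contributes nothing.
  · rw [Finset.sum_range_succ, if_neg (by omega), add_zero]
    refine Finset.sum_congr rfl fun j hj => ?_
    rw [Finset.mem_range] at hj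
    simp [hj]
  · refine Finset.sum_congr rfl fun i _ => ?_
    -- Column `0` lies outside the triangle in the rows above the bottom one.
    rw [Finset.sum_range_succ', if_neg (by simp), add_zero]
    refine Finset.sum_congr rfl fun j _ => ?_
    exact if_congr (by simp [removeBottom]) rfl rfl

open scoped Classical in
theorem generatingFunction_succ {R : Type*} [CommRing R] (Q : R) {n : ℕ} (k : Fin (n + 1) → ℤ)
    (hk : StrictMono k) :
    generatingFunction Q k = rowSum Q k (generatingFunction Q) := by
  have hdisj : ∀ l ∈ interlacingRows k, ∀ l' ∈ interlacingRows k, l ≠ l' →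
      Disjoint (withBottomRow l) (withBottomRow l') := by
    intro l _ l' _ hne
    refine Finset.disjoint_left.2 fun T h h' => hne ?_
    rw [← mem_withBottomRow.1 h, ← mem_withBottomRow.1 h']
  have hsum : rowSum Q k (generatingFunction Q) =
      ∑ T ∈ (interlacingRows k).biUnion withBottomRow,
        rowWeight Q k T.bottomRow * Q ^ T.numStrictlyBetween := by
    rw [Finset.sum_biUnion hdisj]
    refine Finset.sum_congr rfl fun l _ => ?_
    rw [generatingFunction, Finset.mul_sum]
    exact Finset.sum_congr rfl fun T hT => by rw [mem_withBottomRow.1 hT]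
  rw [hsum]
  refine Finset.sum_bij (fun T _ => T.removeBottom) ?_ ?_ ?_ ?_
  · intro T hT
    refine Finset.mem_biUnion.2 ⟨_, ?_, mem_withBottomRow.2 rfl⟩
    have := T.bottomRow_removeBottom_mem
    rwa [mem_withBottomRow.1 hT] at this
  · intro T hT T' hT' h
    exact removeBottom_injOn ((mem_withBottomRow.1 hT).trans (mem_withBottomRow.1 hT').symm) h
  · intro T hT
    obtain ⟨l, hl, hTl⟩ := Finset.mem_biUnion.1 hT
    rw [← mem_withBottomRow.1 hTl] at hl
    exact ⟨T.addBottom k hk hl, mem_withBottomRow.2 (bottomRow_addBottom T k hk hl), rfl⟩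
  · intro T hT
    rw [pow_numStrictlyBetween, mem_withBottomRow.1 hT]

theorem generatingFunction_zero {R : Type*} [CommRing R] (Q : R) (k : Fin 0 → ℤ) :
    generatingFunction Q k = 1 := by
  let T₀ : MonotoneTriangle 0 := ⟨fun _ _ => 0, by simp, by simp, by simp, by simp⟩
  have hT : ∀ T : MonotoneTriangle 0, T = T₀ := fun T => by
    ext i j
    exact T.zeros i j (by simp)
  have : withBottomRow k = {T₀} := by
    ext T
    simp only [mem_withBottomRow, Finset.mem_singleton]
    exact ⟨fun _ => hT T, fun _ => Subsingleton.elim _ _⟩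
  rw [generatingFunction, this, Finset.sum_singleton]
  simp [numStrictlyBetween]

end MonotoneTriangle

/-! ### The induction on the number of rows -/

theorem theorem1 {R : Type*} [CommRing R] [Algebra ℚ R] (Q : R) (n : ℕ) (k : Fin n → ℤ)
    (hk : StrictMono k) :
    MonotoneTriangle.generatingFunction Q k =
      operatorProduct Q n (vandermondeQuotient R n) k := by
  induction n with
  | zero =>
    rw [MonotoneTriangle.generatingFunction_zero, ← shiftAction_pairProd]
    simp [pairProd, vandermondeQuotient]
  | succ n ih =>
    -- The induction hypothesis covers only strictly increasing rows, which are the only ones in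
    -- `rowSum`. The difference operators are then commuted past the operator product to expose a
    -- full difference.
    rw [MonotoneTriangle.generatingFunction_succ Q k hk, rowSum_congr Q k ih,
      ← shiftAction_pairProd, ← shiftAction_pairProd, vandermondeQuotient_eq_binomDet,
      vandermondeQuotient_eq_binomDet, ← shiftAction_diffProd_binomDet 0 n,
      ← Module.End.mul_apply, ← map_mul, mul_comm, map_mul, Module.End.mul_apply,
      rowSum_diffProd Q k hk _ (vanishesOnDiagonals_pairProd_binomDet Q 1 n),
      alternatingSum_pairProd_binomDet]
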